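/- Let $G$ be a bipartite graph with sides $A$ and $B$, both countably infinite, such that every vertex of $B$ has finite degree. Assume that $G$ has the double Hall property: $|A|\ge 2$ and, for every (finite or infinite) $X\subseteq A$ with $|X|\ge 2$, the set $N^2_G(X)$ of vertices having at least two neighbours in $X$ satisfies $|N^2_G(X)|\ge |X|$. Then $G$ contains an infinite cycle that covers all vertices of $A$; moreover, this cycle can be chosen to be a double ray both of whose tails belong to the same end of $G$. Here a ray is a one-way infinite path and a double ray a two-way infinite path. Two rays are equivalent if for every finite $F\subset V(G)$ they have tails in the same component of $G\setminus F$, and the equivalence classes are the ends of $G$. Let $|G|$ be the set consisting of the points of $G$, viewed as a $1$-complex, and the ends of $G$, with the following topology. Basic open neighbourhoods of a vertex are the open stars of radius $1/n$ around it, those of an inner point of an edge are the open intervals of the edge containing it, and those of an end $\varepsilon$ are the sets $\Omega(F,\varepsilon)\cup C(F,\varepsilon)\cup E(F,\varepsilon)$ for finite $F\subset V(G)$. In the last case $C(F,\varepsilon)$ is the component of $G\setminus F$ containing a tail of every ray in $\varepsilon$, $\Omega(F,\varepsilon)$ is the set of ends $\varepsilon'$ with $C(F,\varepsilon')=C(F,\varepsilon)$,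 and $E(F,\varepsilon)$ is the set of all inner points of edges between $F$ and $C(F,\varepsilon)$. A circle is a subset of $|G|$ homeomorphic to the unit circle $\mathbb S^1$; the cycle it defines is the subgraph consisting of the edges having an inner point in it, together with their endvertices. An infinite cycle is such a cycle with infinitely many vertices. -/

import Mathlib

namespace DoubleHall

variable {V : Type*}

/-! ### Bipartite graphs and the double Hall property -/

/-- `G` is a bipartite graph with sides `A` and `B`: the sides partition the vertex set and every
edge joins the two sides. -/
structure HasSides (G : SimpleGraph V) (A B : Set V) : Prop where
  bipartite : G.IsBipartiteWith A B
  union_eq : A ∪ B = Set.univ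

/-- `N²(X)`: the vertices with at least two neighbours in `X`. -/
def secondNeighbors (G : SimpleGraph V) (X : Set V) : Set V :=
  {w | ∃ x ∈ X, ∃ y ∈ X, x ≠ y ∧ G.Adj w x ∧ G.Adj w y}

/-- The double Hall property with respect to the side `A`: `|A| ≥ 2` and `|N²(X)| ≥ |X|`
(as cardinal numbers) for every `X ⊆ A`, finite or infinite, with at least two elements. -/
structure DoubleHallProperty (G : SimpleGraph V) (A : Set V) : Prop where
  two_le : 2 ≤ Cardinal.mk A
  card_le : ∀ X : Set V, X ⊆ A → 2 ≤ Cardinal.mk X →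
    Cardinal.mk X ≤ Cardinal.mk (secondNeighbors G X)

/-! ### Rays and ends -/

/-- A ray: a one-way infinite path, listed from its first vertex. -/
structure Ray (G : SimpleGraph V) where
  toFun : ℕ → V
  injective : Function.Injective toFun
  adj : ∀ n, G.Adj (toFun n) (toFun (n + 1))

/-- The set `S` contains a tail of the ray `r`. -/
def Ray.HasTailIn {G : SimpleGraph V} (r : Ray G) (S : Set V) : Prop :=
  ∃ m, ∀ n, m ≤ n → r.toFun n ∈ S

theorem Ray.HasTailIn.inter_nonempty {G : SimpleGraph V} {r : Ray G} {S T : Set V}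
    (hS : r.HasTailIn S) (hT : r.HasTailIn T) : (S ∩ T).Nonempty := by
  obtain ⟨m, hm⟩ := hS
  obtain ⟨k, hk⟩ := hT
  exact ⟨r.toFun (max m k), hm _ (le_max_left _ _), hk _ (le_max_right _ _)⟩

/-- A ray has tails in at most one component of `G - F`. -/
theorem Ray.component_unique {G : SimpleGraph V} {r : Ray G} {F : Set V}
    {C D : G.ComponentCompl F} (hC : r.HasTailIn (C : Set V)) (hD : r.HasTailIn (D : Set V)) :
    C = D := by
  by_contra hne
  obtain ⟨v, hvC, hvD⟩ := hC.inter_nonempty hD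
  exact Set.disjoint_left.mp (SimpleGraph.ComponentCompl.pairwise_disjoint hne) hvC hvD

/-- For finite `F`, every ray has a tail in some component of `G - F`. -/
theorem Ray.exists_component {G : SimpleGraph V} (r : Ray G) (F : Finset V) :
    ∃ C : G.ComponentCompl (F : Set V), r.HasTailIn (C : Set V) := by
  have hfin : (r.toFun ⁻¹' (F : Set V)).Finite :=
    F.finite_toSet.preimage r.injective.injOn
  obtain ⟨m, hm⟩ := hfin.bddAbove
  have hout : ∀ n, m + 1 ≤ n → r.toFun n ∉ (F : Set V) := fun n hn hF => by
    have := hm hF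
    omega
  refine ⟨G.componentComplMk (hout (m + 1) le_rfl), m + 1, fun n hn => ?_⟩
  induction n, hn using Nat.le_induction with
  | base => exact G.componentComplMk_mem _
  | succ n hn ih =>
    exact SimpleGraph.ComponentCompl.mem_of_adj _ _ ih (hout _ (by omega)) (r.adj n)

/-- Two rays are equivalent if, for every finite set `F` of vertices, they have tails in the same
component of `G - F`. -/
def Ray.Equivalent {G : SimpleGraph V} (r s : Ray G) : Prop :=
  ∀ F : Finset V, ∃ C : G.ComponentCompl (F : Set V),
    r.HasTailIn (C : Set V) ∧ s.HasTailIn (C : Set V)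

instance raySetoid (G : SimpleGraph V) : Setoid (Ray G) where
  r := Ray.Equivalent
  iseqv :=
    { refl := fun r F => (r.exists_component F).imp fun _ h => ⟨h, h⟩
      symm := fun h F => (h F).imp fun _ h => ⟨h.2, h.1⟩
      trans := fun h₁ h₂ F => by
        obtain ⟨C, hrC, hsC⟩ := h₁ F
        obtain ⟨D, hsD, htD⟩ := h₂ F
        obtain rfl := Ray.component_unique hsC hsD
        exact ⟨C, hrC, htD⟩ }

/-- The ends of `G`: equivalence classes of rays. -/
def GraphEnd (G : SimpleGraph V) : Type _ := Quotient (raySetoid G)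

/-- The end containing a ray. -/
def Ray.toEnd {G : SimpleGraph V} (r : Ray G) : GraphEnd G := Quotient.mk (raySetoid G) r

theorem GraphEnd.existsUnique_component {G : SimpleGraph V} (ε : GraphEnd G) (F : Finset V) :
    ∃! C : G.ComponentCompl (F : Set V), ∀ r : Ray G, r.toEnd = ε → r.HasTailIn (C : Set V) := by
  obtain ⟨s, rfl⟩ : ∃ s : Ray G, s.toEnd = ε := Quotient.exists_rep ε
  obtain ⟨C, hC⟩ := s.exists_component F
  refine ⟨C, fun r hr => ?_, fun D hD => Ray.component_unique (hD s rfl) hC⟩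
  have hrs : Ray.Equivalent r s := Quotient.exact hr
  obtain ⟨D, hrD, hsD⟩ := hrs F
  obtain rfl := Ray.component_unique hC hsD
  exact hrD

/-- `C(F, ε)`: the component of `G - F` that contains a tail of every ray in the end `ε`. -/
noncomputable def GraphEnd.component {G : SimpleGraph V} (ε : GraphEnd G) (F : Finset V) :
    G.ComponentCompl (F : Set V) :=
  (ε.existsUnique_component F).choose

/-! ### The space `|G|` -/

/-- The point at distance `t` from `x` on the segment from `x` to `y`, in barycentric
coordinates. -/
noncomputable def segmentPoint (x y : V) (t : ℝ) : V →₀ ℝ :=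
  Finsupp.single x (1 - t) + Finsupp.single y t

/-- `f` is an inner point of the edge `xy` of `G`. -/
def IsInnerPoint (G : SimpleGraph V) (x y : V) (f : V →₀ ℝ) : Prop :=
  G.Adj x y ∧ ∃ t : ℝ, 0 < t ∧ t < 1 ∧ f = segmentPoint x y t

/-- The points of `G` viewed as a 1-complex, in barycentric coordinates: a point is either a vertex
or an inner point of an edge, every edge being a copy of the unit interval. -/
def Point (G : SimpleGraph V) : Type _ :=
  {f : V →₀ ℝ // (∃ v, f = Finsupp.single v 1) ∨ ∃ x y, IsInnerPoint G x y f}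

/-- The point set of `|G|`: the points of the 1-complex `G` together with the ends of `G`. -/
inductive EndSpace (G : SimpleGraph V) where
  | point (p : Point G) : EndSpace G
  | atEnd (ε : GraphEnd G) : EndSpace G

/-- The open star of radius `r` (where `0 < r ≤ 1`) around the vertex `v`: the points of the
1-complex at distance less than `r` from `v` on an edge at `v`. The coordinate at `v` of a point at
distance `t` from `v` on such an edge is `1 - t`. -/
def openStar (G : SimpleGraph V) (v : V) (r : ℝ) : Set (EndSpace G) :=
  {q | ∃ p : Point G, q = .point p ∧ 1 - p.1 v < r}

/-- An open interval of inner points of the edge `xy`. -/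
def edgeInterval (G : SimpleGraph V) (x y : V) (a b : ℝ) : Set (EndSpace G) :=
  {q | ∃ p : Point G, q = .point p ∧ ∃ t : ℝ, a < t ∧ t < b ∧ p.1 = segmentPoint x y t}

/-- The basic open neighbourhood `Ω(F, ε) ∪ C(F, ε) ∪ E(F, ε)` of the end `ε`. -/
def endNeighborhood {G : SimpleGraph V} (ε : GraphEnd G) (F : Finset V) : Set (EndSpace G) :=
  -- the ends that belong to the component `C(F, ε)`
  {q | ∃ ε' : GraphEnd G, q = .atEnd ε' ∧ ε'.component F = ε.component F} ∪
  -- the vertices of `C(F, ε)` and the inner points of its edges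
  {q | ∃ p : Point G, q = .point p ∧ ∀ v, p.1 v ≠ 0 → v ∈ ε.component F} ∪
  -- the inner points of the edges between `F` and `C(F, ε)`
  {q | ∃ p : Point G, q = .point p ∧
    ∃ x ∈ F, ∃ y ∈ ε.component F, IsInnerPoint G x y p.1}

/-- The topology of `|G|`: generated by the open stars of radius `1 / n` around vertices, the open
intervals of inner points of edges, and the basic open neighbourhoods of ends. -/
instance (G : SimpleGraph V) : TopologicalSpace (EndSpace G) :=
  TopologicalSpace.generateFrom
    ({U | ∃ (v : V) (n : ℕ), 1 ≤ n ∧ U = openStar G v (1 / (n : ℝ))} ∪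
     {U | ∃ (x y : V) (a b : ℝ), G.Adj x y ∧ 0 ≤ a ∧ b ≤ 1 ∧ U = edgeInterval G x y a b} ∪
     {U | ∃ (ε : GraphEnd G) (F : Finset V), U = endNeighborhood ε F})

/-! ### Circles, cycles and double rays -/

/-- A circle in `|G|`: a subset homeomorphic (in the subspace topology) to the unit circle. -/
def IsCircle {G : SimpleGraph V} (C : Set (EndSpace G)) : Prop :=
  Nonempty (C ≃ₜ Metric.sphere (0 : EuclideanSpace ℝ (Fin 2)) 1)

theorem IsInnerPoint.symm {G : SimpleGraph V} {x y : V} {f : V →₀ ℝ} (h : IsInnerPoint G x y f) :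
    IsInnerPoint G y x f := by
  obtain ⟨hxy, t, h0, h1, rfl⟩ := h
  refine ⟨hxy.symm, 1 - t, by linarith, by linarith, ?_⟩
  simp [segmentPoint, add_comm]

/-- The subgraph of `G` consisting of the edges that have an inner point in `C`, together with
their endvertices. -/
def definedSubgraph {G : SimpleGraph V} (C : Set (EndSpace G)) : G.Subgraph where
  verts := {x | ∃ y, ∃ p : Point G, IsInnerPoint G x y p.1 ∧ .point p ∈ C}
  Adj x y := ∃ p : Point G, IsInnerPoint G x y p.1 ∧ .point p ∈ C
  adj_sub := fun ⟨_, h, _⟩ => h.1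
  edge_vert := fun {_ y} h => ⟨y, h⟩
  symm := ⟨fun _ _ ⟨p, h, hp⟩ => ⟨p, h.symm, hp⟩⟩

/-- A cycle of `G`, finite or infinite: the subgraph defined by a circle in `|G|`. -/
def IsTopologicalCycle {G : SimpleGraph V} (H : G.Subgraph) : Prop :=
  ∃ C : Set (EndSpace G), IsCircle C ∧ H = definedSubgraph C

/-- An infinite cycle of `G`: a cycle with infinitely many vertices. -/
def IsInfiniteCycle {G : SimpleGraph V} (H : G.Subgraph) : Prop :=
  IsTopologicalCycle H ∧ H.verts.Infinite

/-- A double ray: a two-way infinite path. -/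
structure DoubleRay (G : SimpleGraph V) where
  toFun : ℤ → V
  injective : Function.Injective toFun
  adj : ∀ n, G.Adj (toFun n) (toFun (n + 1))

/-- The half-ray `D 0, D 1, D 2, …` of a double ray `D`. -/
def DoubleRay.forward {G : SimpleGraph V} (D : DoubleRay G) : Ray G where
  toFun n := D.toFun n
  injective := D.injective.comp Nat.cast_injective
  adj n := by simpa using D.adj n

/-- The half-ray `D 0, D (-1), D (-2), …` of a double ray `D`. -/
def DoubleRay.backward {G : SimpleGraph V} (D : DoubleRay G) : Ray G where
  toFun n := D.toFun (-n)
  injective := D.injective.comp (neg_injective.comp Nat.cast_injective)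
  adj n := by
    have h := D.adj (-((n : ℤ) + 1))
    rw [show -((n : ℤ) + 1) + 1 = -n by ring] at h
    simpa using h.symm

/-- The vertices and edges of a double ray, as a subgraph. -/
def DoubleRay.toSubgraph {G : SimpleGraph V} (D : DoubleRay G) : G.Subgraph where
  verts := Set.range D.toFun
  Adj x y := ∃ n : ℤ, (x = D.toFun n ∧ y = D.toFun (n + 1)) ∨ (y = D.toFun n ∧ x = D.toFun (n + 1))
  adj_sub := by
    rintro x y ⟨n, ⟨rfl, rfl⟩ | ⟨rfl, rfl⟩⟩
    · exact D.adj n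
    · exact (D.adj n).symm
  edge_vert := by
    rintro x y ⟨n, ⟨rfl, rfl⟩ | ⟨rfl, rfl⟩⟩
    · exact ⟨n, rfl⟩
    · exact ⟨n + 1, rfl⟩
  symm := ⟨fun _ _ ⟨n, h⟩ => ⟨n, h.symm⟩⟩

end DoubleHall

namespace DoubleHall

variable {V : Type*}

/-! ### Construction of the double ray -/

/-! The double Hall property is needed only for pairs: two vertices of `A` have two common
neighbours, hence one that avoids any prescribed vertex. As degrees in `B` are finite, a finite set
`U` has only finitely many neighbours in `A`. So there is a fresh `c ∈ A` with no neighbour in `U`,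
and every path through `c` enters and leaves it outside `U`.

Thus `p ∈ A` is joined to a new target `t ∈ A` by a path `p, b, c, b', t` whose vertices after `p`
are new (`exists_path_avoiding`). Extending a path alternately at its two ends, with targets taken
from an enumeration of `A`, gives a double ray through all of `A` (`exists_doubleRay`).

The same remark puts all rays in one end: beyond the neighbours of a finite `F`, vertices of two
rays have a common neighbour, which lies outside `F` (`Ray.equivalent_of_doubleHallProperty`). Both
tails of the double ray therefore converge to one end, and adding this end closes the line to a copy
of the one-point compactification of `ℝ`, which is a circle (`isEmbedding_closedCurve`). -/

theorem DoubleHallProperty.exists_common_neighbor_ne {G : SimpleGraph V} {A : Set V}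
    (h : DoubleHallProperty G A) {x y : V} (hx : x ∈ A) (hy : y ∈ A) (hxy : x ≠ y) (z : V) :
    ∃ w, w ≠ z ∧ G.Adj w x ∧ G.Adj w y := by
  have h2 : (2 : Cardinal) ≤ Cardinal.mk ({x, y} : Set V) :=
    Cardinal.two_le_iff.mpr ⟨⟨x, by simp⟩, ⟨y, by simp⟩, by simpa [Subtype.ext_iff] using hxy⟩
  obtain ⟨⟨u, hu⟩, ⟨v, hv⟩, huv⟩ := Cardinal.two_le_iff.mp
    (h2.trans (h.card_le {x, y} (by rintro _ (rfl | rfl) <;> assumption) h2))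
  have key : ∀ w ∈ secondNeighbors G {x, y}, G.Adj w x ∧ G.Adj w y := by
    rintro w ⟨a, rfl | rfl, b, rfl | rfl, hab, h1, h2⟩ <;> simp_all
  by_cases huz : u = z
  · exact ⟨v, fun hvz => huv (Subtype.ext (huz.trans hvz.symm)), key v hv⟩
  · exact ⟨u, huz, key u hu⟩

theorem HasSides.finite_setOf_adj {G : SimpleGraph V} {A B : Set V} (hG : HasSides G A B)
    (hfin : ∀ b ∈ B, (G.neighborSet b).Finite) (U : Finset V) :
    {a | a ∈ A ∧ ∃ w ∈ U, G.Adj w a}.Finite := by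
  have : (⋃ w ∈ {w | w ∈ U ∧ w ∈ B}, G.neighborSet w).Finite :=
    (U.finite_toSet.subset fun w hw => hw.1).biUnion fun w hw => hfin w hw.2
  refine this.subset ?_
  rintro a ⟨ha, w, hw, hwa⟩
  exact Set.mem_biUnion (show w ∈ {w | w ∈ U ∧ w ∈ B} from
    ⟨hw, hG.bipartite.mem_of_mem_adj ha hwa.symm⟩) hwa

theorem HasSides.exists_mem_not_adj {G : SimpleGraph V} {A B : Set V} (hG : HasSides G A B)
    (hA : A.Infinite) (hfin : ∀ b ∈ B, (G.neighborSet b).Finite) (U : Finset V) :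
    ∃ c ∈ A, c ∉ U ∧ ∀ w ∈ U, ¬ G.Adj w c := by
  obtain ⟨c, hcA, hc⟩ := (hA.sdiff (U.finite_toSet.union (hG.finite_setOf_adj hfin U))).nonempty
  refine ⟨c, hcA, fun h => hc (Or.inl h), fun w hw hwc => hc (Or.inr ⟨hcA, w, hw, hwc⟩)⟩

open Classical in
/-- From a vertex `p ∈ A` there is a path with four edges to a new vertex of `A` that avoids a given
finite set; it may be made to end in a prescribed new vertex. -/
theorem exists_path_avoiding {G : SimpleGraph V} {A B : Set V} (hG : HasSides G A B)
    (hA : A.Infinite) (hdHp : DoubleHallProperty G A)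
    (hfin : ∀ b ∈ B, (G.neighborSet b).Finite) (U : Finset V) {p a : V} (hp : p ∈ A) (ha : a ∈ A) :
    ∃ f : ℕ → V, f 3 ∈ A ∧ G.Adj p (f 0) ∧ (∀ i < 3, G.Adj (f i) (f (i + 1))) ∧
      (∀ i < 4, ∀ j < 4, f i = f j → i = j) ∧ (∀ i < 4, f i ∉ U) ∧ (a ∈ U ∨ a = f 3) := by
  obtain ⟨t, htA, htU, hat⟩ : ∃ t ∈ A, t ∉ U ∧ (a ∈ U ∨ a = t) := by
    by_cases haU : a ∈ U
    · obtain ⟨c, hc, hcU, -⟩ := hG.exists_mem_not_adj hA hfin U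
      exact ⟨c, hc, hcU, Or.inl haU⟩
    · exact ⟨a, ha, haU, Or.inr rfl⟩
  -- All neighbours of `c` avoid `t`, `p` and `U`, so `b` and `b'` will be new automatically.
  obtain ⟨c, hcA, hc, hcadj⟩ := hG.exists_mem_not_adj hA hfin (insert t (insert p U))
  simp only [Finset.mem_insert, not_or] at hc
  -- The avoided vertex `p` is a dummy here; the second choice must avoid `b`.
  obtain ⟨b, -, hbp, hbc⟩ := hdHp.exists_common_neighbor_ne hp hcA (Ne.symm hc.2.1) p
  obtain ⟨b', hbb', hbc', hbt'⟩ := hdHp.exists_common_neighbor_ne hcA htA hc.1 b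
  have hnew : ∀ w, G.Adj w c → w ∉ insert t (insert p U) := fun w h hw => hcadj w hw h
  have hb := hnew b hbc
  have hb' := hnew b' hbc'
  simp only [Finset.mem_insert, not_or] at hb hb'
  have h1 := hbc.ne
  have h2 := hbc'.ne
  refine ⟨fun i => match i with | 0 => b | 1 => c | 2 => b' | _ => t, htA, hbp.symm, ?_, ?_, ?_, hat⟩
  · intro i hi
    interval_cases i
    exacts [hbc, hbc'.symm, hbt']
  · intro i hi j hj
    interval_cases i <;> interval_cases j <;> simp_all [eq_comm]
  · intro i hi
    interval_cases i <;> simp_all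

/-- A state in the construction of the double ray: the set `used` of all vertices used so far, the
two ends `first` and `second` of the current path, and the piece added last. -/
structure PathState (V : Type*) (A : Set V) where
  used : Finset V
  first : V
  second : V
  piece : ℕ → V
  first_mem : first ∈ A
  second_mem : second ∈ A

open Classical in
/-- `t` arises from `s` by extending the path of `s` by four edges at its end `first`; afterwards
`a` is used and the roles of the two ends are swapped. -/
structure PathState.Extends {A : Set V} (G : SimpleGraph V) (a : V) (s t : PathState V A) :
    Prop where
  first_eq : t.first = s.second
  second_eq : t.second = t.piece 3
  adj_zero : G.Adj s.first (t.piece 0)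
  adj : ∀ i < 3, G.Adj (t.piece i) (t.piece (i + 1))
  inj : ∀ i < 4, ∀ j < 4, t.piece i = t.piece j → i = j
  notMem : ∀ i < 4, t.piece i ∉ s.used
  used_eq : t.used = s.used ∪ (Finset.range 4).image t.piece
  mem : a ∈ t.used

open Classical in
-- `f n` is the piece added in step `n`. Since the ends are swapped each time, pieces of equal
-- parity lie on the same side of `x`, which is why `f n` continues in `f (n + 2)`.
theorem exists_pieces {G : SimpleGraph V} {A B : Set V} (hG : HasSides G A B)
    (hA : A.Countable) (hA' : A.Infinite) (hdHp : DoubleHallProperty G A)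
    (hfin : ∀ b ∈ B, (G.neighborSet b).Finite) :
    ∃ (x : V) (f : ℕ → ℕ → V),
      (∀ n, ∀ i < 4, f n i ≠ x) ∧
      (∀ n m, ∀ i < 4, ∀ j < 4, f n i = f m j → n = m ∧ i = j) ∧
      G.Adj x (f 0 0) ∧ G.Adj x (f 1 0) ∧ (∀ n, G.Adj (f n 3) (f (n + 2) 0)) ∧
      (∀ n, ∀ i < 3, G.Adj (f n i) (f n (i + 1))) ∧
      ∀ a ∈ A, a = x ∨ ∃ n, ∃ i < 4, a = f n i := by
  obtain ⟨e, he⟩ := hA.exists_eq_range hA'.nonempty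
  have heA : ∀ n, e n ∈ A := fun n => he ▸ Set.mem_range_self n
  have step : ∀ (n : ℕ) (s : PathState V A), ∃ t, s.Extends G (e n) t := by
    intro n s
    obtain ⟨f, h3, h0, hadj, hinj, hU, ha⟩ :=
      exists_path_avoiding hG hA' hdHp hfin s.used s.first_mem (heA n)
    refine ⟨⟨s.used ∪ (Finset.range 4).image f, s.second, f 3, f, s.second_mem, h3⟩,
      rfl, rfl, h0, hadj, hinj, hU, rfl, ?_⟩
    rcases ha with ha | ha
    · exact Finset.mem_union_left _ ha
    · exact Finset.mem_union_right _ (ha ▸ Finset.mem_image_of_mem f (by simp))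
  choose next hnext using step
  -- The initial path is the single vertex `e 0`, serving as both ends; its piece `e` is a dummy
  -- that is never read.
  let S : ℕ → PathState V A := fun n =>
    Nat.rec ⟨{e 0}, e 0, e 0, e, heA 0, heA 0⟩ (fun n s => next n s) n
  have hS : ∀ n, (S n).Extends G (e n) (S (n + 1)) := fun n => hnext n (S n)
  have mono : Monotone fun n => (S n).used := monotone_nat_of_le_succ fun n => by
    simp only [(hS n).used_eq]
    exact Finset.subset_union_left
  have piece_mem : ∀ n, ∀ i < 4, (S (n + 1)).piece i ∈ (S (n + 1)).used := fun n i hi => by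
    rw [(hS n).used_eq]
    exact Finset.mem_union_right _ (Finset.mem_image_of_mem _ (Finset.mem_range.mpr hi))
  have x_mem : ∀ n, e 0 ∈ (S n).used := fun n =>
    mono (Nat.zero_le n) (show e 0 ∈ ({e 0} : Finset V) by simp)
  have ne_of_lt : ∀ n m, n < m → ∀ i < 4, ∀ j < 4, (S (n + 1)).piece i ≠ (S (m + 1)).piece j :=
    fun n m hnm i hi j hj h =>
      (hS m).notMem j hj (h ▸ mono (Nat.succ_le_of_lt hnm) (piece_mem n i hi))
  have mem_used : ∀ n, ∀ a ∈ (S n).used, a = e 0 ∨ ∃ m, ∃ i < 4, a = (S (m + 1)).piece i := by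
    intro n
    induction n with
    | zero => exact fun a ha => Or.inl (Finset.mem_singleton.mp ha)
    | succ n ih =>
      intro a ha
      rw [(hS n).used_eq, Finset.mem_union] at ha
      rcases ha with ha | ha
      · exact ih a ha
      · obtain ⟨i, hi, rfl⟩ := Finset.mem_image.mp ha
        exact Or.inr ⟨n, i, Finset.mem_range.mp hi, rfl⟩
  refine ⟨e 0, fun n => (S (n + 1)).piece, ?_, ?_, (hS 0).adj_zero, ?_, ?_, fun n => (hS n).adj, ?_⟩
  · intro n i hi h
    have h' : (S (n + 1)).piece i = e 0 := h
    exact (hS n).notMem i hi (h' ▸ x_mem n)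
  · intro n m i hi j hj h
    rcases lt_trichotomy n m with hlt | rfl | hlt
    · exact absurd h (ne_of_lt n m hlt i hi j hj)
    · exact ⟨rfl, (hS n).inj i hi j hj h⟩
    · exact absurd h.symm (ne_of_lt m n hlt j hj i hi)
  · have h := (hS 1).adj_zero
    have h' : (S 1).first = e 0 := (hS 0).first_eq
    rwa [h'] at h
  · intro n
    have h := (hS (n + 2)).adj_zero
    rwa [(hS (n + 1)).first_eq, (hS n).second_eq] at h
  · intro a ha
    rw [he] at ha
    obtain ⟨n, rfl⟩ := ha
    exact mem_used (n + 1) _ (hS n).mem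

theorem exists_doubleRay {G : SimpleGraph V} {A B : Set V} (hG : HasSides G A B)
    (hA : A.Countable) (hA' : A.Infinite) (hdHp : DoubleHallProperty G A)
    (hfin : ∀ b ∈ B, (G.neighborSet b).Finite) :
    ∃ D : DoubleRay G, A ⊆ Set.range D.toFun := by
  obtain ⟨x, f, hx, hinj, h0, h1, h3, hadj, hcov⟩ := exists_pieces hG hA hA' hdHp hfin
  -- `e` is the parity of the side, `k / 4` counts the pieces on it and `k % 4` is the position
  -- within the piece. Even pieces fill the positive integers, odd ones the negative integers.
  have side : ∀ e k : ℕ, G.Adj (f (2 * (k / 4) + e) (k % 4))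
      (f (2 * ((k + 1) / 4) + e) ((k + 1) % 4)) := by
    intro e k
    by_cases hk : k % 4 = 3
    · have := h3 (2 * (k / 4) + e)
      rwa [hk, show (k + 1) % 4 = 0 by omega,
        show 2 * ((k + 1) / 4) + e = 2 * (k / 4) + e + 2 by omega]
    · have := hadj (2 * (k / 4) + e) (k % 4) (by omega)
      rwa [show (k + 1) % 4 = k % 4 + 1 by omega, show (k + 1) / 4 = k / 4 by omega]
  refine ⟨⟨fun z => match z with
    | Int.ofNat 0 => x
    | Int.ofNat (k + 1) => f (2 * (k / 4) + 0) (k % 4)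
    | Int.negSucc k => f (2 * (k / 4) + 1) (k % 4), ?_, ?_⟩, ?_⟩
  · have hlt : ∀ k, k % 4 < 4 := fun k => Nat.mod_lt k (by norm_num)
    rintro ((_ | k) | k) ((_ | l) | l) h
    · rfl
    · exact absurd h.symm (hx _ _ (hlt l))
    · exact absurd h.symm (hx _ _ (hlt l))
    · exact absurd h (hx _ _ (hlt k))
    · have := hinj _ _ _ (hlt k) _ (hlt l) h
      rw [show k = l by omega]
    · have := hinj _ _ _ (hlt k) _ (hlt l) h
      omega
    · exact absurd h (hx _ _ (hlt k))
    · have := hinj _ _ _ (hlt k) _ (hlt l) h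
      omega
    · have := hinj _ _ _ (hlt k) _ (hlt l) h
      rw [show k = l by omega]
  · rintro ((_ | k) | (_ | k))
    · exact h0
    · exact side 0 k
    · exact h1.symm
    · exact (side 1 k).symm
  · intro a ha
    rcases hcov a ha with rfl | ⟨n, i, hi, rfl⟩
    · exact ⟨0, rfl⟩
    · rcases Nat.even_or_odd' n with ⟨m, rfl | rfl⟩
      · refine ⟨Int.ofNat (4 * m + i + 1), ?_⟩
        change f (2 * ((4 * m + i) / 4) + 0) ((4 * m + i) % 4) = _
        rw [show (4 * m + i) / 4 = m by omega, show (4 * m + i) % 4 = i by omega]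
        rfl
      · refine ⟨Int.negSucc (4 * m + i), ?_⟩
        change f (2 * ((4 * m + i) / 4) + 1) ((4 * m + i) % 4) = _
        rw [show (4 * m + i) / 4 = m by omega, show (4 * m + i) % 4 = i by omega]

/-! ### All rays are equivalent -/

theorem Ray.exists_mem_not_adj {G : SimpleGraph V} {A B : Set V} (hG : HasSides G A B)
    (hfin : ∀ b ∈ B, (G.neighborSet b).Finite) (r : Ray G) (F : Finset V) (m : ℕ) :
    ∃ n, m ≤ n ∧ r.toFun n ∈ A ∧ ∀ w ∈ F, ¬ G.Adj w (r.toFun n) := by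
  have hfinite := (hG.finite_setOf_adj hfin F).preimage (f := r.toFun) r.injective.injOn
  obtain ⟨k, hk⟩ := hfinite.bddAbove
  -- Of two consecutive vertices of the ray, one lies in `A`.
  obtain ⟨n, hn, hnA⟩ : ∃ n, max m (k + 1) ≤ n ∧ r.toFun n ∈ A := by
    have hAB : r.toFun (max m (k + 1)) ∈ A ∪ B := hG.union_eq ▸ Set.mem_univ _
    rcases hAB with h | h
    · exact ⟨_, le_rfl, h⟩
    · exact ⟨_, Nat.le_succ _, hG.bipartite.symm.mem_of_mem_adj h (r.adj _)⟩
  refine ⟨n, (le_max_left _ _).trans hn, hnA, fun w hw hadj => ?_⟩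
  have h1 : n ≤ k := hk (show n ∈ r.toFun ⁻¹' _ from ⟨hnA, w, hw, hadj⟩)
  have h2 := (le_max_right _ _).trans hn
  omega

theorem Ray.equivalent_of_doubleHallProperty {G : SimpleGraph V} {A B : Set V}
    (hG : HasSides G A B) (hdHp : DoubleHallProperty G A)
    (hfin : ∀ b ∈ B, (G.neighborSet b).Finite) (r s : Ray G) : r.Equivalent s := by
  intro F
  obtain ⟨C, m, hm⟩ := r.exists_component F
  obtain ⟨C', k, hk⟩ := s.exists_component F
  suffices C = C' from ⟨C, ⟨m, hm⟩, this ▸ ⟨k, hk⟩⟩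
  obtain ⟨i, hi, hiA, hiF⟩ := r.exists_mem_not_adj hG hfin F m
  obtain ⟨j, hj, hjA, hjF⟩ := s.exists_mem_not_adj hG hfin F k
  have hri := hm i hi
  have hsj := hk j hj
  have key : s.toFun j ∈ C := by
    by_cases h : r.toFun i = s.toFun j
    · exact h ▸ hri
    · obtain ⟨w, -, hwi, hwj⟩ := hdHp.exists_common_neighbor_ne hiA hjA h (r.toFun i)
      have hwF : w ∉ (F : Set V) := fun hw => hiF w hw hwi
      have hwC : w ∈ C := SimpleGraph.ComponentCompl.mem_of_adj _ _ hri hwF hwi.symm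
      exact SimpleGraph.ComponentCompl.mem_of_adj _ _ hwC
        (SimpleGraph.ComponentCompl.notMem_of_mem hsj) hwj
  by_contra hne
  exact Set.disjoint_left.mp (SimpleGraph.ComponentCompl.pairwise_disjoint hne) key hsj

/-! ### Barycentric coordinates -/

open Classical in
theorem segmentPoint_apply (x y v : V) (t : ℝ) :
    segmentPoint x y t v = (if x = v then 1 - t else 0) + (if y = v then t else 0) := by
  simp only [segmentPoint, Finsupp.add_apply, Finsupp.single_apply]

theorem IsInnerPoint.pos_right {G : SimpleGraph V} {x y : V} {f : V →₀ ℝ}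
    (h : IsInnerPoint G x y f) : 0 < f y := by
  obtain ⟨hxy, t, h0, h1, rfl⟩ := h
  simpa [segmentPoint_apply, hxy.ne] using h0

theorem IsInnerPoint.pos_left {G : SimpleGraph V} {x y : V} {f : V →₀ ℝ}
    (h : IsInnerPoint G x y f) : 0 < f x :=
  h.symm.pos_right

theorem IsInnerPoint.eq_or_eq_of_ne_zero {G : SimpleGraph V} {x y v : V} {f : V →₀ ℝ}
    (h : IsInnerPoint G x y f) (hv : f v ≠ 0) : v = x ∨ v = y := by
  obtain ⟨hxy, t, h0, h1, rfl⟩ := h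
  by_contra! hne
  exact hv (by simp [segmentPoint_apply, hne.1.symm, hne.2.symm])

theorem Point.nonneg {G : SimpleGraph V} (p : Point G) (v : V) : 0 ≤ p.1 v := by
  classical
  obtain ⟨f, ⟨x, rfl⟩ | ⟨x, y, hxy, t, h0, h1, rfl⟩⟩ := p
  · simp only [Finsupp.single_apply]
    split_ifs <;> norm_num
  · simp only [segmentPoint_apply]
    split_ifs <;> linarith

/-- Two positive coordinates determine the edge. This turns membership in the basic open sets into
inequalities between coordinates. -/
theorem Point.isInnerPoint_of_pos {G : SimpleGraph V} (p : Point G) {x y : V} (hxy : x ≠ y)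
    (hx : 0 < p.1 x) (hy : 0 < p.1 y) : IsInnerPoint G x y p.1 := by
  classical
  obtain ⟨f, ⟨v, rfl⟩ | ⟨v, w, h⟩⟩ := p
  · simp only [Finsupp.single_apply] at hx hy
    split_ifs at hx hy with h1 h2
    · exact absurd (h1.symm.trans h2) hxy
    all_goals simp at hx hy
  · rcases h.eq_or_eq_of_ne_zero hx.ne' with rfl | rfl <;>
      rcases h.eq_or_eq_of_ne_zero hy.ne' with rfl | rfl
    · exact absurd rfl hxy
    · exact h
    · exact h.symm
    · exact absurd rfl hxy

theorem Point.exists_pos {G : SimpleGraph V} (p : Point G) : ∃ v, 0 < p.1 v := by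
  obtain ⟨f, ⟨v, rfl⟩ | ⟨v, w, h⟩⟩ := p
  · exact ⟨v, by simp⟩
  · exact ⟨w, h.pos_right⟩

theorem point_mem_openStar {G : SimpleGraph V} {p : Point G} {v : V} {r : ℝ} :
    EndSpace.point p ∈ openStar G v r ↔ 1 - p.1 v < r := by
  constructor
  · rintro ⟨q, hq, h⟩
    cases hq
    exact h
  · exact fun h => ⟨p, rfl, h⟩

theorem point_mem_edgeInterval {G : SimpleGraph V} {p : Point G} {x y : V} (hxy : x ≠ y)
    {a b : ℝ} (ha : 0 ≤ a) (hb : b ≤ 1) :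
    EndSpace.point p ∈ edgeInterval G x y a b ↔ 0 < p.1 x ∧ a < p.1 y ∧ p.1 y < b := by
  constructor
  · rintro ⟨q, hq, t, hat, htb, h⟩
    cases hq
    have hx : p.1 x = 1 - t := by rw [h]; simp [segmentPoint_apply, hxy.symm]
    have hy : p.1 y = t := by rw [h]; simp [segmentPoint_apply, hxy]
    rw [hx, hy]
    exact ⟨by linarith, hat, htb⟩
  · rintro ⟨hx, hy, hy'⟩
    obtain ⟨-, t, -, -, h⟩ := p.isInnerPoint_of_pos hxy hx (ha.trans_lt hy)
    have ht : p.1 y = t := by rw [h]; simp [segmentPoint_apply, hxy]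
    exact ⟨p, rfl, t, ht ▸ hy, ht ▸ hy', h⟩

theorem point_mem_endNeighborhood {G : SimpleGraph V} {p : Point G} {ε : GraphEnd G}
    {F : Finset V} :
    EndSpace.point p ∈ endNeighborhood ε F ↔ ∃ y ∈ ε.component F, 0 < p.1 y := by
  constructor
  · rintro ((⟨ε', h, -⟩ | ⟨q, hq, h⟩) | ⟨q, hq, x, -, y, hy, h⟩)
    · cases h
    · cases hq
      obtain ⟨v, hv⟩ := p.exists_pos
      exact ⟨v, h v hv.ne', hv⟩
    · cases hq
      exact ⟨y, hy, h.pos_right⟩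
  · rintro ⟨y, hy, hpos⟩
    by_cases h : ∀ v, p.1 v ≠ 0 → v ∈ ε.component F
    · exact Or.inl (Or.inr ⟨p, rfl, h⟩)
    · push Not at h
      obtain ⟨x, hx, hxC⟩ := h
      have hxy : x ≠ y := fun h => hxC (h ▸ hy)
      have hin := p.isInnerPoint_of_pos hxy ((p.nonneg x).lt_of_ne' hx) hpos
      -- A neighbour `x` of `y` outside the component must lie in `F`, since components absorb
      -- neighbours outside `F`.
      refine Or.inr ⟨p, rfl, x, ?_, y, hy, hin⟩
      by_contra hxF
      exact hxC (SimpleGraph.ComponentCompl.mem_of_adj _ _ hy hxF hin.1.symm)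

theorem atEnd_mem_endNeighborhood {G : SimpleGraph V} {ε ε' : GraphEnd G} {F : Finset V} :
    EndSpace.atEnd ε' ∈ endNeighborhood ε F ↔ ε'.component F = ε.component F := by
  constructor
  · rintro ((⟨ε'', h, h'⟩ | ⟨q, hq, -⟩) | ⟨q, hq, -⟩)
    · cases h
      exact h'
    · cases hq
    · cases hq
  · exact fun h => Or.inl (Or.inl ⟨ε', rfl, h⟩)

theorem GraphEnd.hasTailIn_component {G : SimpleGraph V} {ε : GraphEnd G} {r : Ray G}
    (h : r.toEnd = ε) (F : Finset V) : r.HasTailIn (ε.component F : Set V) :=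
  (ε.existsUnique_component F).choose_spec.1 r h

/-! ### The circle traced by a double ray -/

namespace DoubleRay

variable {G : SimpleGraph V} (D : DoubleRay G)

/-- The parametrisation of the points of a double ray by `ℝ`: the integer `k` is sent to the `k`-th
vertex, and the intervals between consecutive integers are mapped linearly to the edges. -/
noncomputable def arc (t : ℝ) : Point G :=
  ⟨segmentPoint (D.toFun ⌊t⌋) (D.toFun (⌊t⌋ + 1)) (Int.fract t), by
    rcases (Int.fract_nonneg t).eq_or_lt with h | h
    · exact Or.inl ⟨D.toFun ⌊t⌋, by simp [segmentPoint, ← h]⟩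
    · exact Or.inr ⟨_, _, D.adj _, _, h, Int.fract_lt_one t, rfl⟩⟩

/-- Each coordinate is a tent function of `t`; its continuity is visible here, unlike in the
definition through `⌊t⌋`. -/
theorem arc_apply (t : ℝ) (k : ℤ) : (D.arc t).1 (D.toFun k) = max 0 (1 - |t - k|) := by
  have h0 := Int.fract_nonneg t
  have h1 := Int.fract_lt_one t
  have h2 := Int.floor_add_fract t
  simp only [arc, segmentPoint_apply, D.injective.eq_iff]
  rcases lt_trichotomy k ⌊t⌋ with h | h | h
  · have hk : (k : ℝ) + 1 ≤ ⌊t⌋ := by exact_mod_cast h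
    rw [if_neg (by omega), if_neg (by omega), abs_of_nonneg (by linarith),
      max_eq_left (by linarith), add_zero]
  · have hk : (k : ℝ) = ⌊t⌋ := by exact_mod_cast h
    rw [if_pos h.symm, if_neg (by omega), abs_of_nonneg (by linarith), max_eq_right (by linarith)]
    linarith
  · rcases (Int.add_one_le_of_lt h).eq_or_lt with h | h
    · have hk : (⌊t⌋ : ℝ) + 1 = k := by exact_mod_cast h
      rw [if_neg (by omega), if_pos h, abs_of_nonpos (by linarith), max_eq_right (by linarith)]
      linarith
    · have hk : (⌊t⌋ : ℝ) + 1 + 1 ≤ k := by exact_mod_cast h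
      rw [if_neg (by omega), if_neg (by omega), abs_of_nonpos (by linarith),
        max_eq_left (by linarith), add_zero]

theorem arc_apply_of_notMem_range (t : ℝ) {v : V} (hv : v ∉ Set.range D.toFun) :
    (D.arc t).1 v = 0 := by
  simp only [arc, segmentPoint_apply]
  rw [if_neg fun h => hv ⟨_, h⟩, if_neg fun h => hv ⟨_, h⟩, add_zero]

theorem arc_apply_pos_iff {t : ℝ} {k : ℤ} : 0 < (D.arc t).1 (D.toFun k) ↔ |t - k| < 1 := by
  rw [arc_apply, lt_max_iff]
  simp

theorem exists_of_arc_apply_pos {t : ℝ} {v : V} (h : 0 < (D.arc t).1 v) :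
    ∃ k : ℤ, D.toFun k = v ∧ |t - k| < 1 := by
  by_cases hv : v ∈ Set.range D.toFun
  · obtain ⟨k, rfl⟩ := hv
    exact ⟨k, rfl, D.arc_apply_pos_iff.mp h⟩
  · exact absurd (D.arc_apply_of_notMem_range t hv) h.ne'

theorem continuous_arc_apply (v : V) : Continuous fun t => (D.arc t).1 v := by
  by_cases hv : v ∈ Set.range D.toFun
  · obtain ⟨k, rfl⟩ := hv
    simp only [arc_apply]
    fun_prop
  · simp only [D.arc_apply_of_notMem_range _ hv]
    exact continuous_const

/-- The closed curve consisting of the points of a double ray and of an end `ε`. -/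
noncomputable def closedCurve (ε : GraphEnd G) (s : OnePoint ℝ) : EndSpace G :=
  s.elim (.atEnd ε) fun t => .point (D.arc t)

@[simp]
theorem closedCurve_coe (ε : GraphEnd G) (t : ℝ) :
    D.closedCurve ε (t : OnePoint ℝ) = .point (D.arc t) := rfl

@[simp]
theorem closedCurve_infty (ε : GraphEnd G) :
    D.closedCurve ε OnePoint.infty = .atEnd ε := rfl

/-! ### Continuity of the closed curve -/

theorem exists_forall_abs_mem_component {ε : GraphEnd G} (hf : D.forward.toEnd = ε)
    (hb : D.backward.toEnd = ε) (F : Finset V) :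
    ∃ N : ℕ, ∀ k : ℤ, (N : ℤ) ≤ |k| → D.toFun k ∈ ε.component F := by
  obtain ⟨m, hm⟩ := GraphEnd.hasTailIn_component hf F
  obtain ⟨n, hn⟩ := GraphEnd.hasTailIn_component hb F
  refine ⟨max m n, fun k hk => ?_⟩
  push_cast at hk
  have h1 := (le_max_left _ _).trans hk
  have h2 := (le_max_right _ _).trans hk
  obtain ⟨l, rfl | rfl⟩ := Int.eq_nat_or_neg k
  · rw [Nat.abs_cast] at h1
    exact hm l (by exact_mod_cast h1)
  · rw [abs_neg, Nat.abs_cast] at h2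
    exact hn l (by exact_mod_cast h2)

/-- Stars and edge intervals contain no ends, so only openness in `ℝ` matters for them. A
neighbourhood of `ε` must also have a preimage with compact complement, and this holds because both
tails belong to `ε`. -/
theorem continuous_closedCurve {ε : GraphEnd G} (hf : D.forward.toEnd = ε)
    (hb : D.backward.toEnd = ε) : Continuous (D.closedCurve ε) := by
  refine continuous_generateFrom_iff.mpr ?_
  rintro U ((⟨v, n, -, rfl⟩ | ⟨x, y, a, b, hxy, ha, hb, rfl⟩) | ⟨ε', F, rfl⟩)
  · rw [OnePoint.isOpen_iff_of_notMem (by rintro ⟨p, hp, -⟩; cases hp)]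
    simp only [Set.preimage, Set.mem_ofPred_eq,
      closedCurve_coe, point_mem_openStar]
    exact isOpen_lt (continuous_const.sub (D.continuous_arc_apply v)) continuous_const
  · rw [OnePoint.isOpen_iff_of_notMem (by rintro ⟨p, hp, -⟩; cases hp)]
    simp only [Set.preimage, Set.mem_ofPred_eq, closedCurve_coe,
      point_mem_edgeInterval hxy.ne ha hb]
    exact (isOpen_lt continuous_const (D.continuous_arc_apply x)).and
      ((isOpen_lt continuous_const (D.continuous_arc_apply y)).and
        (isOpen_lt (D.continuous_arc_apply y) continuous_const))
  · have hopen : IsOpen ((↑) ⁻¹' (D.closedCurve ε ⁻¹' endNeighborhood ε' F) : Set ℝ) := by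
      have : ((↑) ⁻¹' (D.closedCurve ε ⁻¹' endNeighborhood ε' F) : Set ℝ) =
          ⋃ y ∈ {y | y ∈ ε'.component F}, {t | 0 < (D.arc t).1 y} := by
        ext t
        simp [point_mem_endNeighborhood]
      rw [this]
      exact isOpen_biUnion fun y _ => isOpen_lt continuous_const (D.continuous_arc_apply y)
    refine OnePoint.isOpen_def.mpr ⟨fun hmem => ?_, hopen⟩
    have hε : ε.component F = ε'.component F := atEnd_mem_endNeighborhood.mp hmem
    obtain ⟨N, hN⟩ := D.exists_forall_abs_mem_component hf hb F
    -- The extra `1` absorbs the rounding from `t` to `⌊t⌋`, whose vertex has a positive coordinate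
    -- at `t`.
    refine (isCompact_Icc (a := -((N : ℝ) + 1)) (b := (N : ℝ) + 1)).of_isClosed_subset
      hopen.isClosed_compl fun t ht => ?_
    by_contra hout
    refine ht (point_mem_endNeighborhood.mpr ⟨D.toFun ⌊t⌋, hε ▸ hN _ ?_, ?_⟩)
    · have h1 := Int.floor_le t
      have h2 := Int.lt_floor_add_one t
      rw [Set.mem_Icc, not_and_or, not_le, not_le] at hout
      rcases hout with h | h
      · have : ((N : ℤ) : ℝ) ≤ ((-⌊t⌋ : ℤ) : ℝ) := by push_cast; linarith
        exact (Int.cast_le.mp this).trans (neg_le_abs _)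
      · have : ((N : ℤ) : ℝ) ≤ (⌊t⌋ : ℝ) := by push_cast; linarith
        exact (Int.cast_le.mp this).trans (le_abs_self _)
    · rw [arc_apply_pos_iff, abs_lt]
      constructor <;> linarith [Int.floor_le t, Int.lt_floor_add_one t]

/-! ### The closed curve is an embedding -/

theorem isOpen_openStar (v : V) {n : ℕ} (hn : 1 ≤ n) : IsOpen (openStar G v (1 / (n : ℝ))) :=
  TopologicalSpace.isOpen_generateFrom_of_mem (Or.inl (Or.inl ⟨v, n, hn, rfl⟩))

theorem isOpen_edgeInterval {x y : V} (hxy : G.Adj x y) {a b : ℝ} (ha : 0 ≤ a) (hb : b ≤ 1) :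
    IsOpen (edgeInterval G x y a b) :=
  TopologicalSpace.isOpen_generateFrom_of_mem (Or.inl (Or.inr ⟨x, y, a, b, hxy, ha, hb, rfl⟩))

theorem isOpen_endNeighborhood (ε : GraphEnd G) (F : Finset V) : IsOpen (endNeighborhood ε F) :=
  TopologicalSpace.isOpen_generateFrom_of_mem (Or.inr ⟨ε, F, rfl⟩)

theorem exists_isOpen_preimage_subset_of_coe (ε : GraphEnd G) (t : ℝ) {δ : ℝ} (hδ : 0 < δ) :
    ∃ W : Set (EndSpace G), IsOpen W ∧ D.closedCurve ε t ∈ W ∧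
      D.closedCurve ε ⁻¹' W ⊆ (↑) '' Metric.ball t δ := by
  rcases (Int.fract_nonneg t).eq_or_lt with h | h
  · have ht : t = ⌊t⌋ := by linarith [Int.floor_add_fract t]
    obtain ⟨n, hn⟩ := exists_nat_one_div_lt hδ
    -- Radius at most `1` excludes the zero branch of the tent function.
    have hn1 : (1 : ℝ) / ((n + 1 : ℕ) : ℝ) ≤ 1 := by
      rw [div_le_one (by positivity)]
      exact_mod_cast Nat.le_add_left 1 n
    have hn0 : (0 : ℝ) < 1 / ((n + 1 : ℕ) : ℝ) := by positivity
    refine ⟨openStar G (D.toFun ⌊t⌋) (1 / ((n + 1 : ℕ) : ℝ)), isOpen_openStar _ (by omega), ?_, ?_⟩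
    · rw [closedCurve_coe, point_mem_openStar, arc_apply, ← ht]
      simpa using hn0
    · intro s hs
      induction s using OnePoint.rec with
      | infty => obtain ⟨p, hp, -⟩ := hs; cases hp
      | coe s =>
        refine ⟨s, ?_, rfl⟩
        rw [Set.mem_preimage, closedCurve_coe, point_mem_openStar, arc_apply, ← ht,
          sub_lt_comm, lt_max_iff] at hs
        push_cast at hs hn1
        rw [Metric.mem_ball, Real.dist_eq]
        rcases hs with hs | hs <;> linarith
  · have h1 := Int.fract_lt_one t
    have h2 := Int.floor_add_fract t
    have hadj := D.adj ⌊t⌋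
    -- Positive coordinates at both endvertices force `s` into the same unit interval as `t`; there
    -- the second coordinate is `s - ⌊t⌋`.
    refine ⟨edgeInterval G (D.toFun ⌊t⌋) (D.toFun (⌊t⌋ + 1)) (max 0 (Int.fract t - δ))
      (min 1 (Int.fract t + δ)), isOpen_edgeInterval hadj (le_max_left _ _) (min_le_left _ _),
      ?_, ?_⟩
    · refine ⟨_, rfl, Int.fract t, ?_, ?_, rfl⟩
      · exact max_lt h (by linarith)
      · exact lt_min h1 (by linarith)
    · intro s hs
      induction s using OnePoint.rec with
      | infty => obtain ⟨p, hp, -⟩ := hs; cases hp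
      | coe s =>
        refine ⟨s, ?_, rfl⟩
        rw [Set.mem_preimage, closedCurve_coe,
          point_mem_edgeInterval hadj.ne (le_max_left _ _) (min_le_left _ _)] at hs
        obtain ⟨hx, hy, hy'⟩ := hs
        have hypos := (le_max_left _ _).trans_lt hy
        have hs1 := abs_lt.mp (D.arc_apply_pos_iff.mp hx)
        have hs2 := abs_lt.mp (D.arc_apply_pos_iff.mp hypos)
        have hlow := (le_max_right _ _).trans_lt hy
        have hup := hy'.trans_le (min_le_right _ _)
        push_cast at hs2
        rw [arc_apply, abs_of_nonpos (by push_cast; linarith), Int.cast_add, Int.cast_one,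
          max_eq_right (by linarith)] at hlow hup
        rw [Metric.mem_ball, Real.dist_eq, abs_lt]
        constructor <;> linarith

theorem exists_isOpen_preimage_subset_of_infty (ε : GraphEnd G) (N : ℕ) :
    ∃ W : Set (EndSpace G), IsOpen W ∧ D.closedCurve ε OnePoint.infty ∈ W ∧
      ∀ t : ℝ, D.closedCurve ε t ∈ W → (N : ℝ) < |t| := by
  classical
  -- A point of the curve near the end has a positive coordinate at a vertex of index `|k| > N + 1`,
  -- and `|t - k| < 1`.
  refine ⟨endNeighborhood ε ((Finset.Icc (-(N + 1) : ℤ) (N + 1)).image D.toFun),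
    isOpen_endNeighborhood _ _, atEnd_mem_endNeighborhood.mpr rfl, fun t ht => ?_⟩
  obtain ⟨y, hy, hpos⟩ := point_mem_endNeighborhood.mp ht
  obtain ⟨k, rfl, hk⟩ := D.exists_of_arc_apply_pos hpos
  have hkF := SimpleGraph.ComponentCompl.notMem_of_mem hy
  have hkN : ((N + 1 : ℤ) : ℝ) < ((|k| : ℤ) : ℝ) := by
    rw [Int.cast_lt]
    by_contra! hle
    exact hkF (Finset.mem_coe.mpr
      (Finset.mem_image_of_mem _ (Finset.mem_Icc.mpr (abs_le.mp hle))))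
  push_cast at hkN
  have := abs_sub_abs_le_abs_sub (k : ℝ) t
  rw [abs_sub_comm] at this
  linarith

theorem isEmbedding_closedCurve {ε : GraphEnd G} (hf : D.forward.toEnd = ε)
    (hb : D.backward.toEnd = ε) : Topology.IsEmbedding (D.closedCurve ε) := by
  have hcont := D.continuous_closedCurve hf hb
  have hind : Topology.IsInducing (D.closedCurve ε) := by
    refine Topology.isInducing_iff_nhds.mpr fun s =>
      le_antisymm hcont.continuousAt.le_comap fun U hU => ?_
    induction s using OnePoint.rec with
    | infty =>
      obtain ⟨O, hOU, hO, hmem⟩ := mem_nhds_iff.mp hU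
      have hcpt := ((OnePoint.isOpen_iff_of_mem hmem).mp hO).2
      obtain ⟨R, hR⟩ := hcpt.isBounded.exists_norm_le
      obtain ⟨N, hN⟩ := exists_nat_ge R
      obtain ⟨W, hW, hmemW, hWN⟩ := D.exists_isOpen_preimage_subset_of_infty ε N
      refine Filter.mem_comap.mpr ⟨W, hW.mem_nhds hmemW, fun s hs => hOU ?_⟩
      induction s using OnePoint.rec with
      | infty => exact hmem
      | coe t =>
        by_contra htO
        have h1 := hR t htO
        rw [Real.norm_eq_abs] at h1
        linarith [hWN t hs]
    | coe t =>
      rw [OnePoint.nhds_coe_eq, Filter.mem_map] at hU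
      obtain ⟨δ, hδ, hball⟩ := Metric.mem_nhds_iff.mp hU
      obtain ⟨W, hW, hmemW, hsub⟩ := D.exists_isOpen_preimage_subset_of_coe ε t hδ
      refine Filter.mem_comap.mpr ⟨W, hW.mem_nhds hmemW, hsub.trans ?_⟩
      exact Set.image_subset_iff.mpr hball
  -- An inducing map on the T0 space `OnePoint ℝ` is injective.
  exact ⟨hind, hind.injective⟩

theorem isCircle_range_closedCurve {ε : GraphEnd G} (hf : D.forward.toEnd = ε)
    (hb : D.backward.toEnd = ε) : IsCircle (Set.range (D.closedCurve ε)) :=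
  ⟨(D.isEmbedding_closedCurve hf hb).toHomeomorph.symm.trans
    (onePointEquivSphereOfFinrankEq (by simp))⟩

/-! ### The subgraph defined by the circle -/

theorem exists_isInnerPoint_mem_range_iff (ε : GraphEnd G) {x y : V} :
    (∃ p : Point G, IsInnerPoint G x y p.1 ∧ .point p ∈ Set.range (D.closedCurve ε)) ↔
      D.toSubgraph.Adj x y := by
  have mid : ∀ n : ℤ, IsInnerPoint G (D.toFun n) (D.toFun (n + 1)) (D.arc (n + 1 / 2)).1 := by
    intro n
    refine Point.isInnerPoint_of_pos _ (D.adj n).ne ?_ ?_ <;>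
      rw [arc_apply_pos_iff, abs_lt] <;> push_cast <;> constructor <;> linarith
  constructor
  · rintro ⟨p, hp, s, hs⟩
    induction s using OnePoint.rec with
    | infty => cases hs
    | coe t =>
      cases hs
      obtain ⟨k, rfl, hk⟩ := D.exists_of_arc_apply_pos hp.pos_left
      obtain ⟨l, rfl, hl⟩ := D.exists_of_arc_apply_pos hp.pos_right
      rw [abs_lt] at hk hl
      -- Both indices are at distance less than `1` from `t`, so being distinct they are
      -- consecutive.
      have h1 : (k : ℝ) < ((l + 2 : ℤ) : ℝ) := by push_cast; linarith
      have h2 : (l : ℝ) < ((k + 2 : ℤ) : ℝ) := by push_cast; linarith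
      rw [Int.cast_lt] at h1 h2
      have hne : k ≠ l := fun h => hp.1.ne (h ▸ rfl)
      rcases lt_or_gt_of_ne hne with h | h
      · exact ⟨k, Or.inl ⟨rfl, by rw [show l = k + 1 by omega]⟩⟩
      · exact ⟨l, Or.inr ⟨rfl, by rw [show k = l + 1 by omega]⟩⟩
  · rintro ⟨n, ⟨rfl, rfl⟩ | ⟨rfl, rfl⟩⟩
    · exact ⟨_, mid n, _, D.closedCurve_coe ε _⟩
    · exact ⟨_, (mid n).symm, _, D.closedCurve_coe ε _⟩

theorem definedSubgraph_range_closedCurve (ε : GraphEnd G) :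
    definedSubgraph (Set.range (D.closedCurve ε)) = D.toSubgraph := by
  refine SimpleGraph.Subgraph.ext ?_ ?_
  · ext x
    change (∃ y, ∃ p : Point G, _) ↔ x ∈ Set.range D.toFun
    simp only [D.exists_isInnerPoint_mem_range_iff ε]
    constructor
    · rintro ⟨y, h⟩
      exact D.toSubgraph.edge_vert h
    · rintro ⟨n, rfl⟩
      exact ⟨D.toFun (n + 1), n, Or.inl ⟨rfl, rfl⟩⟩
  · ext x y
    exact D.exists_isInnerPoint_mem_range_iff ε

theorem isInfiniteCycle_toSubgraph (h : D.forward.toEnd = D.backward.toEnd) :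
    IsInfiniteCycle D.toSubgraph :=
  ⟨⟨_, D.isCircle_range_closedCurve h rfl, (D.definedSubgraph_range_closedCurve _).symm⟩,
    Set.infinite_range_of_injective D.injective⟩

end DoubleRay

end DoubleHall

theorem lemma2p11 {V : Type*} (G : SimpleGraph V) (A B : Set V)
    (hG : DoubleHall.HasSides G A B)
    (hA : A.Countable) (hA' : A.Infinite)
    (hB : B.Countable) (hB' : B.Infinite)
    (hdHp : DoubleHall.DoubleHallProperty G A)
    (hfin : ∀ b ∈ B, (G.neighborSet b).Finite) :
    ∃ H : G.Subgraph, DoubleHall.IsInfiniteCycle H ∧ A ⊆ H.verts ∧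
      ∃ D : DoubleHall.DoubleRay G, H = D.toSubgraph ∧
        D.forward.toEnd = D.backward.toEnd := by
  obtain ⟨D, hD⟩ := DoubleHall.exists_doubleRay hG hA hA' hdHp hfin
  have hend : D.forward.toEnd = D.backward.toEnd :=
    Quotient.sound (DoubleHall.Ray.equivalent_of_doubleHallProperty hG hdHp hfin _ _)
  exact ⟨D.toSubgraph, D.isInfiniteCycle_toSubgraph hend, hD, D, rfl, hend⟩
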